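/- All spaces $C(K)$ are the real Banach spaces of continuous real-valued functions on a compact Hausdorff space $K$ with the maximum norm, and $\delta_k\in C(K)^*$ is evaluation at $k$. A linear isometry into $T\colon X\to Y$ between Banach spaces is a U-embedding if for every $x^*\in X^*$ with $\|x^*\|=1$ there is exactly one $y^*\in Y^*$ with $T^*y^*=x^*$ and $\|y^*\|=\|x^*\|$; $X$ can be U-embedded into $Y$ if a U-embedding $X\to Y$ exists. For a weak-star continuous map $F\colon S\to X^*$ on a compact Hausdorff space $S$, let $T_F\colon X\to C(S)$ be the bounded operator $(T_Fx)(s)=\langle x,F(s)\rangle$. A subset $K\subset S$ is a retract of $S$ if there is a retraction, i.e. a continuous map $r\colon S\to K$ with $r(k)=k$ for all $k\in K$; it is a zero set if $K=\{s\in S: f(s)=0\}$ for some $f\in C(S)$. (1) Let $S$ be a compact Hausdorff space and let $K\subset S$ be a retract of $S$ which is a zero set. Then $C(K)$ can be U-embedded into $C(S)$. More precisely, for every retraction $r\colon S\to K$ and every $f\in C(S)$ with $0\le f\le 1$ and $K=f^{-1}(\{0\})$, the map $$F\colon S\to (C(K)^*,w^*),\qquad F(s)=\frac{1-f(s)}{1+f(s)}\,\delta_{r(s)},$$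 is continuous and $T_F\colon C(K)\to C(S)$ is a U-embedding. (2) If $\alpha<\kappa$ are ordinals, then $C([0,\alpha])$ can be U-embedded into $C([0,\kappa])$ (order topologies). (3) Let $K$ and $S$ be compact Hausdorff spaces and let $h\colon K\to S$ be a neighborhood coretraction, i.e. a topological embedding such that every $t\in K$ has a closed neighborhood $V\subset K$ for which $h(V)$ is a retract of $S$. If $h(K)$ is a zero set in $S$, then $C(K)$ can be U-embedded into $C(S)$. -/

import Mathlib

open Topology

universe u v w

/-- `y` is a Hahn--Banach (norm-preserving) extension of `x` through `T`:
`T^* y = x` and `‖y‖ = ‖x‖`. -/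
def IsHahnBanachExtension {X Y : Type*} [NormedAddCommGroup X] [NormedSpace ℝ X]
    [NormedAddCommGroup Y] [NormedSpace ℝ Y] (T : X →L[ℝ] Y)
    (x : StrongDual ℝ X) (y : StrongDual ℝ Y) : Prop :=
  y.comp T = x ∧ ‖y‖ = ‖x‖

/-- A U-embedding: a linear isometry into, such that every norm-one functional has a unique
Hahn--Banach extension through it. -/
def IsUEmbedding {X Y : Type*} [NormedAddCommGroup X] [NormedSpace ℝ X]
    [NormedAddCommGroup Y] [NormedSpace ℝ Y] (T : X →L[ℝ] Y) : Prop :=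
  Isometry T ∧ ∀ x : StrongDual ℝ X, ‖x‖ = 1 → ∃! y : StrongDual ℝ Y, IsHahnBanachExtension T x y

/-- `X` can be U-embedded into `Y`. -/
def UEmbeds (X Y : Type*) [NormedAddCommGroup X] [NormedSpace ℝ X]
    [NormedAddCommGroup Y] [NormedSpace ℝ Y] : Prop :=
  ∃ T : X →L[ℝ] Y, IsUEmbedding T

/-- `r` is a retraction of `S` onto the subset `K` (surjectivity is automatic). -/
def IsRetraction {S : Type*} [TopologicalSpace S] (K : Set S) (r : C(S, K)) : Prop :=
  ∀ k : K, r k = k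

/-- The subset `K` is a retract of `S`. -/
def IsRetract {S : Type*} [TopologicalSpace S] (K : Set S) : Prop :=
  ∃ r : C(S, K), IsRetraction K r

/-- `K` is a zero set in `S`. -/
def IsZeroSet {S : Type*} [TopologicalSpace S] (K : Set S) : Prop :=
  ∃ f : C(S, ℝ), K = {s | f s = 0}

theorem IsZeroSet.compactSpace {S : Type*} [TopologicalSpace S] [CompactSpace S] {K : Set S}
    (hK : IsZeroSet K) : CompactSpace K := by
  obtain ⟨f, rfl⟩ := hK
  exact isCompact_iff_compactSpace.mp (isClosed_eq f.continuous continuous_const).isCompact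

/-- `h : K → S` is a neighborhood coretraction: a topological embedding such that every point of
`K` has a closed neighborhood `V` for which `h(V)` is a retract of `S`. -/
def IsNeighborhoodCoretraction {K S : Type*} [TopologicalSpace K] [TopologicalSpace S]
    (h : K → S) : Prop :=
  IsEmbedding h ∧ ∀ t : K, ∃ V ∈ 𝓝 t, IsClosed V ∧ IsRetract (h '' V)

/-- The Dirac functional `δ_k`, in the dual of `C(K)` with its weak-star topology. -/
noncomputable def diracFunctional {K : Type*} [TopologicalSpace K] [CompactSpace K] (k : K) :
    WeakDual ℝ C(K, ℝ) :=
  StrongDual.toWeakDual (ContinuousMap.evalCLM ℝ k)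

/-- The operator `T_F : X → C(S)`, `(T_F x)(s) = ⟨x, F(s)⟩`, associated with a weak-star
continuous map `F : S → X^*`. -/
noncomputable def operatorOf {X S : Type*} [NormedAddCommGroup X] [NormedSpace ℝ X]
    [CompleteSpace X] [TopologicalSpace S] [CompactSpace S] (F : C(S, WeakDual ℝ X)) :
    X →L[ℝ] C(S, ℝ) :=
  let L : X →ₗ[ℝ] C(S, ℝ) :=
    { toFun := fun x => ⟨fun s => F s x, (WeakDual.eval_continuous x).comp F.continuous⟩
      map_add' := fun x y => by ext s; exact map_add (F s) x y
      map_smul' := fun c x => by ext s; exact map_smul (F s) c x }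
  { L with
    cont := by
      obtain ⟨C, hC⟩ := banach_steinhaus (g := fun s => WeakDual.toStrongDual (F s))
        (fun x => ⟨‖L x‖, fun s => (L x).norm_coe_le_norm s⟩)
      refine (L.mkContinuous (max C 0) fun x => ?_).continuous
      refine (ContinuousMap.norm_le _ (by positivity)).mpr fun s => ?_
      exact (WeakDual.toStrongDual (F s)).le_of_opNorm_le ((hC s).trans (le_max_left _ _)) x }

theorem operatorOf_apply {X S : Type*} [NormedAddCommGroup X] [NormedSpace ℝ X]
    [CompleteSpace X] [TopologicalSpace S] [CompactSpace S] (F : C(S, WeakDual ℝ X))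
    (x : X) (s : S) : operatorOf F x s = F s x := rfl

/-!
All the embeddings are extension operators `T : C(K) → C(S)` along an embedding `e : K → S` that
satisfy `|T x s| ≤ g s * ‖x‖` for a continuous `g ≤ 1` attaining the value `1` only on `e(K)`.
Composing a norm-one functional with restriction along `e` gives one norm-preserving extension of
it. If `y` is any such extension and `|h| ≤ a * (1 - g)`, then adding `h` to `a • T z` for unit
vectors `z` does not raise the norm bound `a`, while `y` almost attains `a` on some `a • T z`;
hence `y h = 0`. By compactness every `h` vanishing on `e(K)` is dominated in this way up to `ε`,
so `y` is determined by its values on the range of `T`.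

A retraction `r` gives such an operator as `x ↦ g * (x ∘ r)`. For a neighborhood coretraction, the
local retractions are glued by a partition of unity along `e(K)`, taken on `S` itself and damped by
`1 - f`, where `f : S → [0, 1]` has zero set `e(K)`.
-/

section HahnBanachExtension

variable {X Y : Type*} [NormedAddCommGroup X] [NormedSpace ℝ X] [NormedAddCommGroup Y]
  [NormedSpace ℝ Y] {T : X →L[ℝ] Y} {R : Y →L[ℝ] X}

theorem isometry_of_comp_eq_id (hT : ‖T‖ ≤ 1) (hR : ‖R‖ ≤ 1)
    (hRT : R ∘L T = ContinuousLinearMap.id ℝ X) : Isometry T := by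
  refine AddMonoidHomClass.isometry_of_norm T fun z => le_antisymm ?_ ?_
  · simpa using T.le_of_opNorm_le hT z
  · simpa [← ContinuousLinearMap.comp_apply, hRT] using R.le_of_opNorm_le hR (T z)

theorem isHahnBanachExtension_comp (hT : ‖T‖ ≤ 1) (hR : ‖R‖ ≤ 1)
    (hRT : R ∘L T = ContinuousLinearMap.id ℝ X) (x : StrongDual ℝ X) :
    IsHahnBanachExtension T x (x.comp R) := by
  have hext : (x.comp R).comp T = x := by
    rw [ContinuousLinearMap.comp_assoc, hRT, ContinuousLinearMap.comp_id]
  refine ⟨hext, le_antisymm ?_ ?_⟩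
  · exact (x.opNorm_comp_le R).trans (mul_le_of_le_one_right (norm_nonneg x) hR)
  · calc ‖x‖ = ‖(x.comp R).comp T‖ := by rw [hext]
      _ ≤ ‖x.comp R‖ * ‖T‖ := (x.comp R).opNorm_comp_le T
      _ ≤ ‖x.comp R‖ := mul_le_of_le_one_right (norm_nonneg _) hT

theorem isUEmbedding_of_comp_eq_id (hT : ‖T‖ ≤ 1) (hR : ‖R‖ ≤ 1)
    (hRT : R ∘L T = ContinuousLinearMap.id ℝ X)
    (hker : ∀ x : StrongDual ℝ X, ‖x‖ = 1 → ∀ y, IsHahnBanachExtension T x y →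
      ∀ h, R h = 0 → y h = 0) :
    IsUEmbedding T := by
  refine ⟨isometry_of_comp_eq_id hT hR hRT, fun x hx =>
    ⟨x.comp R, isHahnBanachExtension_comp hT hR hRT x, fun y hy => ?_⟩⟩
  ext h
  have hR0 : R (h - T (R h)) = 0 := by
    rw [map_sub, ← ContinuousLinearMap.comp_apply R T, hRT, ContinuousLinearMap.id_apply, sub_self]
  calc y h = y (T (R h)) := by rw [← sub_eq_zero, ← map_sub, hker x hx y hy _ hR0]
    _ = x (R h) := by rw [← ContinuousLinearMap.comp_apply, hy.1]

end HahnBanachExtension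

section Domination

variable {X S : Type*} [NormedAddCommGroup X] [NormedSpace ℝ X] [TopologicalSpace S]
  [CompactSpace S] {T : X →L[ℝ] C(S, ℝ)} {x : StrongDual ℝ X} {y : StrongDual ℝ C(S, ℝ)}

/- For unit vectors `z` the bounds give `‖a • T z + h‖ ≤ a + ε`, so `a * x z + y h ≤ a + ε`; now let
`x z` tend to `‖x‖ = 1`. -/
theorem IsHahnBanachExtension.apply_le {g : S → ℝ} (hy : IsHahnBanachExtension T x y)
    (hx : ‖x‖ = 1) (hT : ∀ z s, |T z s| ≤ g s * ‖z‖) {h : C(S, ℝ)} {a ε : ℝ} (ha : 0 < a)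
    (hε : 0 ≤ ε) (hh : ∀ s, |h s| ≤ ε + a * (1 - g s)) : y h ≤ ε := by
  have hnorm (z : X) : ‖a • T z + ‖z‖ • h‖ ≤ (a + ε) * ‖z‖ := by
    refine (ContinuousMap.norm_le _ (by positivity)).2 fun s => ?_
    calc |a * T z s + ‖z‖ * h s| ≤ a * |T z s| + ‖z‖ * |h s| := by
          simpa only [abs_mul, abs_norm, abs_of_pos ha] using abs_add_le (a * T z s) (‖z‖ * h s)
      _ ≤ a * (g s * ‖z‖) + ‖z‖ * (ε + a * (1 - g s)) := by gcongr; exacts [hT z s, hh s]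
      _ = (a + ε) * ‖z‖ := by ring
  have hgain (z : X) : x z ≤ (a + ε - y h) / a * ‖z‖ := by
    have hle : a * x z + ‖z‖ * y h ≤ (a + ε) * ‖z‖ :=
      calc a * x z + ‖z‖ * y h = y (a • T z + ‖z‖ • h) := by
            simp only [← hy.1, ContinuousLinearMap.comp_apply, map_add, map_smul, smul_eq_mul]
        _ ≤ 1 * ((a + ε) * ‖z‖) :=
            (le_abs_self _).trans (y.le_of_opNorm_le_of_le (hy.2.trans hx).le (hnorm z))
        _ = (a + ε) * ‖z‖ := one_mul _
    rw [div_mul_eq_mul_div, le_div_iff₀ ha]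
    linarith
  have hone : 1 ≤ max ((a + ε - y h) / a) 0 := by
    refine hx ▸ x.opNorm_le_bound (le_max_right _ _) fun z => ?_
    refine le_trans (abs_le'.2 ⟨hgain z, ?_⟩) (mul_le_mul_of_nonneg_right (le_max_left _ _)
      (norm_nonneg z))
    simpa only [map_neg, norm_neg] using hgain (-z)
  have := (one_le_div ha).1 ((le_max_iff.1 hone).resolve_right one_pos.not_ge)
  linarith

theorem exists_abs_le_add_mul {h w : C(S, ℝ)} (hw : ∀ s, 0 ≤ w s) (hwh : ∀ s, w s = 0 → h s = 0)
    {ε : ℝ} (hε : 0 < ε) : ∃ a > 0, ∀ s, |h s| ≤ ε + a * w s := by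
  have hcover : Set.univ ⊆ ⋃ n : ℕ, {s | |h s| < ε + n * w s} := fun s _ => by
    refine Set.mem_iUnion.2 ?_
    rcases (hw s).eq_or_lt with h0 | hpos
    · exact ⟨0, by simpa [hwh s h0.symm] using hε⟩
    · obtain ⟨n, hn⟩ := exists_nat_gt (|h s| / w s)
      exact ⟨n, ((div_lt_iff₀ hpos).1 hn).trans (lt_add_of_pos_left _ hε)⟩
  have hmono : Monotone fun n : ℕ => {s | |h s| < ε + n * w s} := fun m n hmn s hs =>
    hs.trans_le <| add_le_add_right (mul_le_mul_of_nonneg_right (Nat.cast_le.2 hmn) (hw s)) ε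
  obtain ⟨n, hn⟩ := isCompact_univ.elim_directed_cover _
    (fun n => isOpen_lt (by fun_prop) (by fun_prop)) hcover hmono.directed_le
  refine ⟨n + 1, n.cast_add_one_pos, fun s => (hn (Set.mem_univ s)).le.trans ?_⟩
  gcongr
  exacts [hw s, (lt_add_one _).le]

theorem IsHahnBanachExtension.apply_eq_zero {g h : C(S, ℝ)} (hy : IsHahnBanachExtension T x y)
    (hx : ‖x‖ = 1) (hT : ∀ z s, |T z s| ≤ g s * ‖z‖) (hg : ∀ s, g s ≤ 1)
    (hgh : ∀ s, g s = 1 → h s = 0) : y h = 0 := by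
  have hle {k : C(S, ℝ)} (hgk : ∀ s, g s = 1 → k s = 0) : y k ≤ 0 := by
    refine le_of_forall_pos_le_add fun ε hε => ?_
    obtain ⟨a, ha, hk⟩ := exists_abs_le_add_mul (h := k) (w := 1 - g)
      (fun s => sub_nonneg.2 (hg s)) (fun s hs => hgk s (sub_eq_zero.1 hs).symm) hε
    rw [zero_add]
    exact hy.apply_le hx hT ha hε.le hk
  have hneg : y (-h) ≤ 0 := hle fun s hs => neg_eq_zero.2 (hgh s hs)
  rw [map_neg, neg_nonpos] at hneg
  exact le_antisymm (hle hgh) hneg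

end Domination

section ContinuousFunctions

variable {K S ι : Type*} [TopologicalSpace K] [TopologicalSpace S]

/-- The composition operator `h ↦ h ∘ e` from `C(S)` to `C(K)`. For the embeddings `e` below it is
restriction to a subspace, and norm-one functionals on `C(K)` are extended through it. -/
noncomputable def pullback (e : C(K, S)) : C(S, ℝ) →L[ℝ] C(K, ℝ) where
  toLinearMap := (ContinuousMap.compRightAlgHom ℝ ℝ e).toLinearMap
  cont := ContinuousMap.compRightAlgHom_continuous ℝ ℝ e

theorem pullback_apply (e : C(K, S)) (h : C(S, ℝ)) (k : K) : pullback e h k = h (e k) := rfl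

theorem norm_pullback_le_one [CompactSpace K] [CompactSpace S] (e : C(K, S)) : ‖pullback e‖ ≤ 1 :=
  (pullback e).opNorm_le_bound zero_le_one fun h => by
    rw [one_mul]
    exact (ContinuousMap.norm_le _ (norm_nonneg h)).2 fun k => h.norm_coe_le_norm (e k)

theorem isUEmbedding_of_abs_apply_le [CompactSpace K] [CompactSpace S] (e : C(K, S))
    {T : C(K, ℝ) →L[ℝ] C(S, ℝ)} {g : C(S, ℝ)} (hg : ∀ s, g s ≤ 1)
    (hge : ∀ s, g s = 1 → s ∈ Set.range e) (hT : ∀ x s, |T x s| ≤ g s * ‖x‖)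
    (hTe : ∀ x k, T x (e k) = x k) : IsUEmbedding T := by
  have hTnorm : ‖T‖ ≤ 1 := T.opNorm_le_bound zero_le_one fun x =>
    (ContinuousMap.norm_le _ (by positivity)).2 fun s =>
      (hT x s).trans (mul_le_mul_of_nonneg_right (hg s) (norm_nonneg x))
  refine isUEmbedding_of_comp_eq_id hTnorm (norm_pullback_le_one e)
    (ContinuousLinearMap.ext fun x => ContinuousMap.ext (hTe x)) fun x hx y hy h hh => ?_
  refine hy.apply_eq_zero hx hT hg fun s hs => ?_
  obtain ⟨k, rfl⟩ := hge s hs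
  rw [← pullback_apply, hh, ContinuousMap.zero_apply]

variable [CompactSpace K] [Fintype ι]

/-- The weak-star continuous map `s ↦ ∑ i, ψ i s • δ_{r i s}`. Its operator glues the composition
operators `x ↦ x ∘ r i` by means of the weights `ψ i`. -/
noncomputable def weightedDirac (ψ : ι → C(S, ℝ)) (r : ι → C(S, K)) :
    C(S, WeakDual ℝ C(K, ℝ)) where
  toFun s := ∑ i, ψ i s • diracFunctional (r i s)
  continuous_toFun := continuous_finsetSum _ fun i _ => (ψ i).continuous.smul <|
    WeakDual.continuous_of_continuous_eval fun x => x.continuous.comp (r i).continuous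

theorem weightedDirac_apply (ψ : ι → C(S, ℝ)) (r : ι → C(S, K)) (s : S) :
    weightedDirac ψ r s = ∑ i, ψ i s • diracFunctional (r i s) := rfl

theorem operatorOf_weightedDirac_apply [CompactSpace S] (ψ : ι → C(S, ℝ)) (r : ι → C(S, K))
    (x : C(K, ℝ)) (s : S) :
    operatorOf (weightedDirac ψ r) x s = ∑ i, ψ i s * x (r i s) := by
  rw [operatorOf_apply, weightedDirac_apply]
  exact map_sum ((topDualPairing ℝ C(K, ℝ)).flip x) _ _

theorem isUEmbedding_operatorOf_weightedDirac [CompactSpace S] (e : C(K, S))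
    {ψ : ι → C(S, ℝ)} {r : ι → C(S, K)} (hψ : ∀ i s, 0 ≤ ψ i s) (hsum : ∀ s, ∑ i, ψ i s ≤ 1)
    (hsum_eq : ∀ s, ∑ i, ψ i s = 1 ↔ s ∈ Set.range e)
    (hr : ∀ i k, ψ i (e k) ≠ 0 → r i (e k) = k) :
    IsUEmbedding (operatorOf (weightedDirac ψ r)) := by
  refine isUEmbedding_of_abs_apply_le e (g := ∑ i, ψ i) (by simpa using hsum)
    (by simpa using fun s => (hsum_eq s).1) (fun x s => ?_) fun x k => ?_
  · rw [operatorOf_weightedDirac_apply, ContinuousMap.sum_apply, Finset.sum_mul]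
    refine (Finset.abs_sum_le_sum_abs _ _).trans (Finset.sum_le_sum fun i _ => ?_)
    rw [abs_mul, abs_of_nonneg (hψ i s)]
    exact mul_le_mul_of_nonneg_left (x.norm_coe_le_norm _) (hψ i s)
  · have hterm (i : ι) : ψ i (e k) * x (r i (e k)) = ψ i (e k) * x k := by
      rcases eq_or_ne (ψ i (e k)) 0 with h0 | h0
      · rw [h0, zero_mul, zero_mul]
      · rw [hr i k h0]
    rw [operatorOf_weightedDirac_apply, Finset.sum_congr rfl fun i _ => hterm i, ← Finset.sum_mul,
      (hsum_eq _).2 ⟨k, rfl⟩, one_mul]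

theorem exists_isUEmbedding_operatorOf_of_leftInverse [CompactSpace S] {e : C(K, S)} {r : C(S, K)}
    (hr : Function.LeftInverse r e) {g : C(S, ℝ)} (hg0 : ∀ s, 0 ≤ g s) (hg1 : ∀ s, g s ≤ 1)
    (hge : ∀ s, g s = 1 ↔ s ∈ Set.range e) :
    ∃ F : C(S, WeakDual ℝ C(K, ℝ)), (∀ s, F s = g s • diracFunctional (r s)) ∧
      IsUEmbedding (operatorOf F) :=
  ⟨weightedDirac (fun _ : Unit => g) fun _ => r, fun s => by simp [weightedDirac_apply],
    isUEmbedding_operatorOf_weightedDirac e (fun _ => hg0) (by simpa using hg1)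
      (by simpa using hge) fun _ k _ => hr k⟩

end ContinuousFunctions

section ZeroSets

variable {S S' : Type*} [TopologicalSpace S] [TopologicalSpace S'] {K : Set S}

theorem IsZeroSet.exists_mem_Icc (hK : IsZeroSet K) :
    ∃ f : C(S, ℝ), (∀ s, f s ∈ Set.Icc 0 1) ∧ ∀ s, f s = 0 ↔ s ∈ K := by
  obtain ⟨f, rfl⟩ := hK
  refine ⟨⟨fun s => min |f s| 1, by fun_prop⟩,
    fun s => ⟨le_min (abs_nonneg _) zero_le_one, min_le_right _ _⟩, fun s => ?_⟩
  change min |f s| 1 = 0 ↔ f s = 0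
  grind

theorem IsZeroSet.preimage (hK : IsZeroSet K) (p : C(S', S)) : IsZeroSet (p ⁻¹' K) := by
  obtain ⟨f, rfl⟩ := hK
  exact ⟨f.comp p, rfl⟩

theorem IsZeroSet.isClosed (hK : IsZeroSet K) : IsClosed K := by
  obtain ⟨f, rfl⟩ := hK
  exact isClosed_eq f.continuous continuous_const

theorem isZeroSet_of_isClopen (hK : IsClopen K) : IsZeroSet K :=
  ⟨LocallyConstant.charFn ℝ hK.compl, by
    ext s; simp [LocallyConstant.charFn_eq_zero]⟩

theorem isZeroSet_Iic_ordinal (α : Ordinal) : IsZeroSet (Set.Iic α) :=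
  isZeroSet_of_isClopen ⟨isClosed_Iic, by rw [← Order.Iio_succ]; exact isOpen_Iio⟩

end ZeroSets

theorem uEmbeds_of_leftInverse {K S : Type*} [TopologicalSpace K] [CompactSpace K]
    [TopologicalSpace S] [CompactSpace S] {e : C(K, S)} {r : C(S, K)}
    (hr : Function.LeftInverse r e) (he : IsZeroSet (Set.range e)) : UEmbeds C(K, ℝ) C(S, ℝ) := by
  obtain ⟨f, hf, hfe⟩ := he.exists_mem_Icc
  obtain ⟨F, -, hF⟩ := exists_isUEmbedding_operatorOf_of_leftInverse hr (g := 1 - f)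
    (fun s => sub_nonneg.2 (hf s).2) (fun s => sub_le_self _ (hf s).1)
    fun s => by simpa using hfe s
  exact ⟨_, hF⟩

theorem IsRetraction.exists_isUEmbedding_operatorOf {S : Type*} [TopologicalSpace S]
    [CompactSpace S] {K : Set S} [CompactSpace K] {r : C(S, K)} (hr : IsRetraction K r)
    {f : C(S, ℝ)} (hK : K = {s | f s = 0}) (hf : ∀ s, 0 ≤ f s ∧ f s ≤ 1) :
    ∃ F : C(S, WeakDual ℝ C(K, ℝ)),
      (∀ s, F s = ((1 - f s) / (1 + f s)) • diracFunctional (r s)) ∧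
      IsUEmbedding (operatorOf F) := by
  have hpos (s : S) : 0 < 1 + f s := by linarith [(hf s).1]
  let e : C(K, S) := ⟨(↑), continuous_subtype_val⟩
  let g : C(S, ℝ) := ⟨fun s => (1 - f s) / (1 + f s),
    Continuous.div (by fun_prop) (by fun_prop) fun s => (hpos s).ne'⟩
  refine exists_isUEmbedding_operatorOf_of_leftInverse (e := e) (g := g) hr
    (fun s => div_nonneg (sub_nonneg.2 (hf s).2) (hpos s).le)
    (fun s => (div_le_one (hpos s)).2 (by linarith [(hf s).1])) fun s => ?_
  have hrange : s ∈ Set.range e ↔ f s = 0 := Set.ext_iff.1 (Subtype.range_coe.trans hK) s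
  rw [hrange, ContinuousMap.coe_mk, div_eq_one_iff_eq (hpos s).ne']
  constructor <;> intro h <;> linarith

theorem IsRetract.uEmbeds {S : Type*} [TopologicalSpace S] [CompactSpace S] {K : Set S}
    [CompactSpace K] (hK : IsRetract K) (hz : IsZeroSet K) : UEmbeds C(K, ℝ) C(S, ℝ) :=
  let ⟨_, hr⟩ := hK
  uEmbeds_of_leftInverse (e := ⟨(↑), continuous_subtype_val⟩) hr (by simpa using hz)

theorem uEmbeds_continuousMap_Icc {O : Type*} [LinearOrder O] [TopologicalSpace O] [OrderTopology O]
    [CompactIccSpace O] {a b c : O} (hab : a ≤ b) (hbc : b ≤ c) (hb : IsZeroSet (Set.Iic b)) :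
    UEmbeds C(Set.Icc a b, ℝ) C(Set.Icc a c, ℝ) := by
  have hsub : Set.Icc a b ⊆ Set.Icc a c := Set.Icc_subset_Icc_right hbc
  let e : C(Set.Icc a b, Set.Icc a c) := ⟨Set.inclusion hsub, continuous_inclusion hsub⟩
  let r : C(Set.Icc a c, Set.Icc a b) := ⟨fun s => Set.projIcc a b hab s, by fun_prop⟩
  have hrange : Set.range e = (↑) ⁻¹' Set.Iic b := by
    ext s
    simp [e, Set.range_inclusion, s.2.1]
  exact uEmbeds_of_leftInverse (e := e) (r := r) (Set.projIcc_val hab)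
    (hrange ▸ hb.preimage ⟨_, continuous_subtype_val⟩)

namespace IsNeighborhoodCoretraction

variable {K S : Type*} [TopologicalSpace K] [TopologicalSpace S] {h : K → S}

theorem exists_local_leftInverse (hh : IsNeighborhoodCoretraction h) (t : K) :
    ∃ (U : Set S) (r : C(S, K)), IsOpen U ∧ h t ∈ U ∧ ∀ k, h k ∈ U → r (h k) = k := by
  obtain ⟨hemb, hloc⟩ := hh
  obtain ⟨V, hV, -, ρ, hρ⟩ := hloc t
  obtain ⟨U, hU, hUV⟩ := hemb.isOpen_iff.1 (isOpen_interior (s := V))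
  have hmem (k : K) : h k ∈ U ↔ k ∈ interior V := Set.ext_iff.1 hUV k
  refine ⟨U, ⟨fun s => hemb.toHomeomorph.symm ⟨ρ s, Set.image_subset_range _ _ (ρ s).2⟩,
    by fun_prop⟩, hU, (hmem t).2 (mem_interior_iff_mem_nhds.2 hV), fun k hk => ?_⟩
  have hk' : h k ∈ h '' V := Set.mem_image_of_mem h (interior_subset ((hmem k).1 hk))
  have hρk : (ρ (h k) : S) = h k := congrArg Subtype.val (hρ ⟨h k, hk'⟩)
  exact hemb.toHomeomorph.symm_apply_eq.2 (Subtype.ext hρk)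

theorem exists_finite_cover [CompactSpace K] (hh : IsNeighborhoodCoretraction h) :
    ∃ (A : Finset K) (U : A → Set S) (r : A → C(S, K)), (∀ i, IsOpen (U i)) ∧
      Set.range h ⊆ ⋃ i, U i ∧ ∀ i k, h k ∈ U i → r i (h k) = k := by
  choose U r hU hmem hr using hh.exists_local_leftInverse
  obtain ⟨A, hA⟩ := (isCompact_range hh.1.continuous).elim_finite_subcover U hU
    (Set.range_subset_iff.2 fun t => Set.mem_iUnion_of_mem t (hmem t))
  rw [← Set.iUnion_subtype (· ∈ A) fun i => U i] at hA
  exact ⟨A, fun i => U i, fun i => r i, fun i => hU i, hA, fun i => hr i⟩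

theorem uEmbeds [CompactSpace K] [CompactSpace S] [NormalSpace S]
    (hh : IsNeighborhoodCoretraction h) (hz : IsZeroSet (Set.range h)) :
    UEmbeds C(K, ℝ) C(S, ℝ) := by
  obtain ⟨f, hf, hfh⟩ := hz.exists_mem_Icc
  obtain ⟨A, U, r, hU, hcover, hr⟩ := hh.exists_finite_cover
  obtain ⟨φ, hφ⟩ := PartitionOfUnity.exists_isSubordinate hz.isClosed U hU hcover
  have hφ_le (s : S) : ∑ i, φ i s ≤ 1 := by
    simpa only [finsum_eq_sum_of_fintype] using φ.sum_le_one s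
  have hφ_eq {s : S} (hs : s ∈ Set.range h) : ∑ i, φ i s = 1 := by
    simpa only [finsum_eq_sum_of_fintype] using φ.sum_eq_one hs
  have hprod_le (s : S) : (1 - f s) * ∑ i, φ i s ≤ 1 - f s :=
    mul_le_of_le_one_right (sub_nonneg.2 (hf s).2) (hφ_le s)
  refine ⟨_, isUEmbedding_operatorOf_weightedDirac ⟨h, hh.1.continuous⟩
    (ψ := fun i => (1 - f) * φ i) (r := r)
    (fun i s => mul_nonneg (sub_nonneg.2 (hf s).2) (φ.nonneg i s)) ?_ ?_ ?_⟩
  · intro s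
    simp only [ContinuousMap.mul_apply, ContinuousMap.sub_apply, ContinuousMap.one_apply,
      ← Finset.mul_sum]
    linarith [hprod_le s, (hf s).1]
  · intro s
    simp only [ContinuousMap.mul_apply, ContinuousMap.sub_apply, ContinuousMap.one_apply,
      ← Finset.mul_sum, ContinuousMap.coe_mk]
    refine ⟨fun hs => (hfh s).1 (by linarith [hprod_le s, (hf s).1]), fun hs => ?_⟩
    rw [hφ_eq hs, (hfh s).2 hs, sub_zero, one_mul]
  · intro i k hk
    exact hr i k (hφ i (subset_tsupport _ (right_ne_zero_of_mul hk)))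

end IsNeighborhoodCoretraction

theorem mainTheorem9_general :
    (∀ (S : Type u) [TopologicalSpace S] [CompactSpace S] (K : Set S) (hK : IsZeroSet K),
      IsRetract K →
        haveI : CompactSpace K := hK.compactSpace
        UEmbeds C(K, ℝ) C(S, ℝ) ∧
        ∀ (r : C(S, K)) (f : C(S, ℝ)), IsRetraction K r → K = {s | f s = 0} →
          (∀ s, 0 ≤ f s ∧ f s ≤ 1) →
          ∃ F : C(S, WeakDual ℝ C(K, ℝ)),
            (∀ s, F s = ((1 - f s) / (1 + f s)) • diracFunctional (r s)) ∧
            IsUEmbedding (operatorOf F)) ∧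
    (∀ (O : Type w) [LinearOrder O] [TopologicalSpace O] [OrderTopology O] [CompactIccSpace O]
      (a b c : O), a ≤ b → b ≤ c → IsZeroSet (Set.Iic b) →
        UEmbeds C(Set.Icc a b, ℝ) C(Set.Icc a c, ℝ)) ∧
    (∀ (K : Type v) (S : Type u) [TopologicalSpace K] [CompactSpace K]
      [TopologicalSpace S] [CompactSpace S] [NormalSpace S] (h : K → S),
        IsNeighborhoodCoretraction h → IsZeroSet (Set.range h) →
        UEmbeds C(K, ℝ) C(S, ℝ)) :=
  ⟨fun _ _ _ _ hK hret =>
    haveI := hK.compactSpace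
    ⟨hret.uEmbeds hK, fun _ _ hr hf h01 => hr.exists_isUEmbedding_operatorOf hf h01⟩,
    fun _ _ _ _ _ _ _ _ hab hbc hb => uEmbeds_continuousMap_Icc hab hbc hb,
    fun _ _ _ _ _ _ _ _ hh hz => hh.uEmbeds hz⟩

theorem mainTheorem9 :
    -- a retract which is a zero set
    (∀ (S : Type u) [TopologicalSpace S] [CompactSpace S] [T2Space S] (K : Set S)
      (hK : IsZeroSet K), IsRetract K →
        haveI : CompactSpace K := hK.compactSpace
        UEmbeds C(K, ℝ) C(S, ℝ) ∧
        -- every retraction and every defining function produce an explicit U-embedding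
        ∀ (r : C(S, K)) (f : C(S, ℝ)), IsRetraction K r → K = {s | f s = 0} →
          (∀ s, 0 ≤ f s ∧ f s ≤ 1) →
          ∃ F : C(S, WeakDual ℝ C(K, ℝ)),
            (∀ s, F s = ((1 - f s) / (1 + f s)) • diracFunctional (r s)) ∧
            IsUEmbedding (operatorOf F)) ∧
    -- ordinal intervals
    (∀ α κ : Ordinal.{w}, α < κ →
      UEmbeds C(Set.Icc (0 : Ordinal.{w}) α, ℝ) C(Set.Icc (0 : Ordinal.{w}) κ, ℝ)) ∧
    -- neighborhood coretractions whose image is a zero set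
    (∀ (K : Type v) (S : Type u) [TopologicalSpace K] [CompactSpace K] [T2Space K]
      [TopologicalSpace S] [CompactSpace S] [T2Space S] (h : K → S),
        IsNeighborhoodCoretraction h → IsZeroSet (Set.range h) →
        UEmbeds C(K, ℝ) C(S, ℝ)) :=
  let ⟨hretract, hinterval, hcoretraction⟩ := mainTheorem9_general.{u, v, w + 1}
  ⟨fun S _ _ _ => hretract S, fun _ _ h => hinterval _ _ _ _ bot_le h.le (isZeroSet_Iic_ordinal _),
    fun K S _ _ _ _ _ _ => hcoretraction K S⟩
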